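/- Let $n\in\mathbb N$, let $\mathbb R^{n\times n}$ carry the trace inner product $\langle\cdot,\cdot\rangle$ and the Frobenius norm $\|\cdot\|$, let $\mathfrak B_n=\{X\in\mathbb R^{n\times n}: Xe=e,\ X^Te=e,\ X\ge 0\}$ (with $e$ the all-ones vector) be the Birkhoff polytope, $\Pi_{\mathfrak B_n}$ the Euclidean projector onto it and $\delta^*_{\mathfrak B_n}(Z)=\sup_{X\in\mathfrak B_n}\langle Z,X\rangle$. Let $\mathcal Q:\mathbb R^{n\times n}\to\mathbb R^{n\times n}$ be a self-adjoint positive semidefinite linear operator, $G,\widehat X\in\mathbb R^{n\times n}$, $\sigma>0$, and put $$\mathcal L_\sigma(Z,W;\widehat X)=\delta^*_{\mathfrak B_n}(Z)+\tfrac12\langle W,\mathcal QW\rangle-\langle \widehat X,Z+\mathcal QW+G\rangle+\tfrac{\sigma}{2}\|Z+\mathcal QW+G\|^2 ,$$ $$\psi(W)=\inf_{Z\in\mathbb R^{n\times n}}\mathcal L_\sigma(Z,W;\widehat X),\qquad Z(W)=\widehat X-\sigma(\mathcal QW+G),\qquad W\in\mathrm{Ran}(\mathcal Q).$$ Let $\nabla\psi$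 be the gradient of $\psi$ on the Euclidean space $\mathrm{Ran}(\mathcal Q)$. Let $\mathcal B:\mathbb R^{n\times n}\to\mathbb R^{2n}$ map a matrix to its row sums followed by its column sums. For $Y\in\mathbb R^{n\times n}$, the HS-Jacobian of $\Pi_{\mathfrak B_n}$ at $Y$ is the operator $$\mathcal P_Y=\Xi-\Xi\mathcal B^*(\mathcal B\,\Xi\,\mathcal B^*)^{\dagger}\mathcal B\,\Xi ,$$ where $\Xi(H)_{ij}=0$ if $\Pi_{\mathfrak B_n}(Y)_{ij}=0$, $\Xi(H)_{ij}=H_{ij}$ otherwise, and $\dagger$ is the Moore–Penrose pseudo-inverse. Algorithm Ssncg2. Given $\mu\in(0,1/2)$, $\bar\eta\in(0,1)$, $\tau\in(0,1]$, $\delta\in(0,1)$ and $W^0\in\mathrm{Ran}(\mathcal Q)$, iterate for $j=0,1,\dots$: 1. Let $\mathcal M_j=\mathcal Q+\sigma\mathcal Q\mathcal P_{Z(W^j)}\mathcal Q$. Apply the conjugate gradient method, with the zero vector as starting point, to the linear system $\mathcal M_j\,dW+\nabla\psi(W^j)=0$, $dW\in\mathrm{Ran}(\mathcal Q)$, and let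 $dW^j$ be an iterate of it with $\|\mathcal M_j dW^j+\nabla\psi(W^j)\|\le\min(\bar\eta,\|\nabla\psi(W^j)\|^{1+\tau})$. 2. Let $m_j$ be the first nonnegative integer $m$ with $\psi(W^j+\delta^m dW^j)\le\psi(W^j)+\mu\delta^m\langle\nabla\psi(W^j),dW^j\rangle$. 3. Set $W^{j+1}=W^j+\delta^{m_j}dW^j$. Theorem. Let $\{W^j\}$ be an infinite sequence generated by Algorithm Ssncg2. Then the problem $\min\{\psi(W): W\in\mathrm{Ran}(\mathcal Q)\}$ has a unique optimal solution $\overline W\in\mathrm{Ran}(\mathcal Q)$, the sequence $\{W^j\}$ converges to $\overline W$, and $$\|W^{j+1}-\overline W\|=O\big(\|W^j-\overline W\|^{1+\tau}\big)\qquad (j\to\infty).$$ -/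

import Mathlib

open Filter Topology Asymptotics
open scoped RealInnerProductSpace

noncomputable section

namespace BirkhoffQP

/-- The space of real `n × n` matrices with the trace inner product and the Frobenius norm;
the entry in row `i` and column `j` of `X` is `X (i, j)`. -/
abbrev MatSpace (n : ℕ) : Type := EuclideanSpace ℝ (Fin n × Fin n)

/-- The Birkhoff polytope, i.e. the set of doubly stochastic matrices. -/
def birkhoff (n : ℕ) : Set (MatSpace n) :=
  {X | (Matrix.of fun i j => X (i, j)) ∈ doublyStochastic ℝ (Fin n)}

theorem mem_birkhoff {n : ℕ} {X : MatSpace n} :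
    X ∈ birkhoff n ↔ (∀ i j, 0 ≤ X (i, j)) ∧ (∀ i, ∑ j, X (i, j) = 1) ∧
      ∀ j, ∑ i, X (i, j) = 1 := by
  simp [birkhoff, mem_doublyStochastic_iff_sum]

theorem exists_proj {n : ℕ} (X : MatSpace n) :
    ∃ Y ∈ birkhoff n, ∀ V ∈ birkhoff n, ‖X - Y‖ ≤ ‖X - V‖ := by
  have hne : (birkhoff n).Nonempty := by
    refine ⟨WithLp.toLp 2 fun p => (1 : Matrix (Fin n) (Fin n) ℝ) p.1 p.2, ?_⟩
    exact (doublyStochastic ℝ (Fin n)).one_mem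
  have hcl : IsClosed (birkhoff n) := by
    have h : birkhoff n = {X : MatSpace n | (∀ i j, 0 ≤ X (i, j)) ∧ (∀ i, ∑ j, X (i, j) = 1) ∧
        ∀ j, ∑ i, X (i, j) = 1} := by
      ext X
      exact mem_birkhoff
    rw [h]
    simp only [Set.ofPred_and, Set.ofPred_forall]
    refine IsClosed.inter ?_ (IsClosed.inter ?_ ?_)
    · exact isClosed_iInter fun i => isClosed_iInter fun j =>
        isClosed_le (by fun_prop) (by fun_prop)
    · exact isClosed_iInter fun i => isClosed_eq (by fun_prop) (by fun_prop)
    · exact isClosed_iInter fun i => isClosed_eq (by fun_prop) (by fun_prop)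
  obtain ⟨Y, hY, hmin⟩ := hcl.exists_infDist_eq_dist hne X
  refine ⟨Y, hY, fun V hV => ?_⟩
  rw [← dist_eq_norm, ← dist_eq_norm, ← hmin]
  exact Metric.infDist_le_dist_of_mem hV

/-- The Euclidean projector onto the Birkhoff polytope (the nearest point exists, and it is unique
since the polytope is convex). -/
def proj {n : ℕ} (X : MatSpace n) : MatSpace n := (exists_proj X).choose

/-- The Moore-Penrose pseudo-inverse of a linear map between finite-dimensional Euclidean spaces:
the orthogonal projection onto the range of `A`, followed by the inverse of the bijection
from the orthogonal complement of the kernel of `A` onto the range of `A`. -/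
def pinv {E F : Type*} [NormedAddCommGroup E] [InnerProductSpace ℝ E] [FiniteDimensional ℝ E]
    [NormedAddCommGroup F] [InnerProductSpace ℝ F] [FiniteDimensional ℝ F]
    (A : E →ₗ[ℝ] F) : F →ₗ[ℝ] E :=
  (LinearMap.ker A)ᗮ.subtype ∘ₗ
    ((A.kerComplementEquivRange
      (Submodule.isCompl_orthogonal
        (K := LinearMap.ker A)).symm).symm : LinearMap.range A →ₗ[ℝ] (LinearMap.ker A)ᗮ) ∘ₗ
    ((LinearMap.range A).orthogonalProjectionOnto : F →ₗ[ℝ] LinearMap.range A)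

/-- The row sums and the column sums of a matrix. -/
def sums (n : ℕ) : MatSpace n →ₗ[ℝ] EuclideanSpace ℝ (Fin n ⊕ Fin n) where
  toFun X := WithLp.toLp 2 (Sum.elim (fun i => ∑ j, X (i, j)) (fun j => ∑ i, X (i, j)))
  map_add' X Y := by
    ext k
    rcases k with i | j <;> simp [Finset.sum_add_distrib]
  map_smul' c X := by
    ext k
    rcases k with i | j <;> simp [Finset.mul_sum]

open Classical in
/-- The linear operator that sets to zero all the entries of `H` at which the projection of `Y`
onto the Birkhoff polytope vanishes, and keeps all the others. -/
def mask {n : ℕ} (Y : MatSpace n) : MatSpace n →ₗ[ℝ] MatSpace n where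
  toFun H := WithLp.toLp 2 fun p => if proj Y p = 0 then 0 else H p
  map_add' H K := by
    ext p
    by_cases h : proj Y p = 0 <;> simp [h]
  map_smul' c H := by
    ext p
    by_cases h : proj Y p = 0 <;> simp [h]

/-- The HS-Jacobian `Ξ - Ξ B* (B Ξ B*)† B Ξ` at `Y` of the projector onto the Birkhoff polytope,
where `Ξ = mask Y` and `B = sums n`. -/
def hsJacobian {n : ℕ} (Y : MatSpace n) : MatSpace n →ₗ[ℝ] MatSpace n :=
  mask Y - mask Y ∘ₗ (sums n).adjoint ∘ₗ
    pinv (sums n ∘ₗ mask Y ∘ₗ (sums n).adjoint) ∘ₗ sums n ∘ₗ mask Y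

/-- The support function of the Birkhoff polytope, the conjugate of its indicator function. -/
def supportFn {n : ℕ} (Z : MatSpace n) : ℝ := sSup ((fun X => ⟪Z, X⟫) '' birkhoff n)

/-- The augmented Lagrangian function `L_σ(Z, W; X)` of the problem to minimize
`supportFn Z + ⟪W, Q W⟫ / 2` subject to `Z + Q W + G = 0` and `W ∈ Ran Q`. -/
def augLagrangian {n : ℕ} (Q : MatSpace n →ₗ[ℝ] MatSpace n) (G : MatSpace n) (σ : ℝ)
    (Z : MatSpace n) (W : LinearMap.range Q) (X : MatSpace n) : ℝ :=
  supportFn Z + 1 / 2 * ⟪(W : MatSpace n), Q W⟫ - ⟪X, Z + Q W + G⟫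
    + σ / 2 * ‖Z + Q W + G‖ ^ 2

/-- The objective function `ψ(W) = inf_Z L_σ(Z, W; X)` of the reduced subproblem, on `Ran Q`. -/
def psi {n : ℕ} (Q : MatSpace n →ₗ[ℝ] MatSpace n) (G : MatSpace n) (σ : ℝ) (X : MatSpace n)
    (W : LinearMap.range Q) : ℝ :=
  ⨅ Z : MatSpace n, augLagrangian Q G σ Z W X

/-- `Z(W) = X - σ (Q W + G)`. -/
def zOf {n : ℕ} (Q : MatSpace n →ₗ[ℝ] MatSpace n) (G : MatSpace n) (σ : ℝ) (X : MatSpace n)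
    (W : LinearMap.range Q) : MatSpace n :=
  X - σ • (Q W + G)

/-- The generalized Hessian `Q + σ Q P Q`, as an operator on `Ran Q`, where `P` is the HS-Jacobian
at `Z(W)` of the projector onto the Birkhoff polytope. -/
def genHessian {n : ℕ} (Q : MatSpace n →ₗ[ℝ] MatSpace n) (G : MatSpace n) (σ : ℝ)
    (X : MatSpace n) (W : LinearMap.range Q) : LinearMap.range Q →ₗ[ℝ] LinearMap.range Q :=
  (Q + σ • (Q ∘ₗ hsJacobian (zOf Q G σ X W) ∘ₗ Q)).restrict fun _ _ =>
    add_mem (LinearMap.mem_range_self _ _)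
      (Submodule.smul_mem _ _ (LinearMap.mem_range_self _ _))

/-- The state of the conjugate gradient method: iterate, residual and search direction. -/
structure CGState (V : Type*) where
  x : V
  r : V
  p : V

/-- The states of the conjugate gradient method for `A x = b` started at the zero vector. After
the residual has become zero the state does not change any more. -/
def cgState {V : Type*} [NormedAddCommGroup V] [InnerProductSpace ℝ V] (A : V →ₗ[ℝ] V) (b : V) :
    ℕ → CGState V
  | 0 => ⟨0, b, b⟩
  | k + 1 =>
    let s := cgState A b k
    let α : ℝ := ⟪s.r, s.r⟫ / ⟪s.p, A s.p⟫
    let r' := s.r - α • A s.p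
    let β : ℝ := ⟪r', r'⟫ / ⟪s.r, s.r⟫
    ⟨s.x + α • s.p, r', r' + β • s.p⟩

/-- One iteration of the semismooth Newton-CG algorithm, from `W` to `W'`. With
`M = genHessian Q G σ X W`, the direction `d` is an iterate of the conjugate gradient method, started
at zero, for the linear system `M d = -∇ψ(W)` in `Ran Q`, that satisfies the stopping test, and `m` is
the first exponent accepted by the line search. -/
def IsStep {n : ℕ} (Q : MatSpace n →ₗ[ℝ] MatSpace n) (G : MatSpace n) (σ : ℝ) (X : MatSpace n)
    (μ ηbar τ δ : ℝ) (W W' : LinearMap.range Q) : Prop :=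
  ∃ (d : LinearMap.range Q) (k m : ℕ),
    d = (cgState (genHessian Q G σ X W) (-gradient (psi Q G σ X) W) k).x ∧
    ‖genHessian Q G σ X W d + gradient (psi Q G σ X) W‖
      ≤ min ηbar (‖gradient (psi Q G σ X) W‖ ^ (1 + τ)) ∧
    IsLeast {i : ℕ | psi Q G σ X (W + δ ^ i • d)
      ≤ psi Q G σ X W + μ * δ ^ i * ⟪gradient (psi Q G σ X) W, d⟫} m ∧
    W' = W + δ ^ m • d

end BirkhoffQP

end

open BirkhoffQP

/-! Minimizing over `Z` in closed form turns `psi` into the quadratic form of `Q` plus a Moreau-type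
convex function of the affine map `zOf`, whose gradient is the nonexpansive projector. Since `Q` is
coercive on its range, `psi` is strongly convex with Lipschitz gradient there, and the generalized
Hessians are uniformly positive definite and bounded (`exists_regularObjective`).

Global convergence: CG iterates from zero satisfy an energy inequality (`cgState_inner_le`) that
makes them descent directions. The stopping test keeps them comparable to the gradient and Armijo
steps stay bounded below, so each step gains a multiple of the squared gradient norm.

Local rate: the polytope is polyhedral and the HS-Jacobian at `Y` is the orthogonal projector onto
the direction space of the minimal face at `proj Y`. Near any `Y₀` this gives the exact identity
`proj Y - proj Y₀ = hsJacobian Y (Y - Y₀)` (`eventually_proj_sub_eq`). Near the minimizer the Newton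
error is thus controlled by the CG residual alone, and unit steps are accepted because `μ < 1/2`
(`isBigO_step`). -/

/-! ### Inexact Newton-CG for an abstract strongly convex objective. -/

section Abstract

variable {V : Type*} [NormedAddCommGroup V] [InnerProductSpace ℝ V]

/-- The conjugate gradient method started at zero does not increase the quadratic energy. -/
theorem cgState_inner_le (A : V →ₗ[ℝ] V) (hsym : A.IsSymmetric)
    (hpos : ∀ x, x ≠ 0 → 0 < ⟪x, A x⟫) (b : V) (k : ℕ) :
    ⟪(cgState A b k).x, A (cgState A b k).x⟫ ≤ 2 * ⟪b, (cgState A b k).x⟫ := by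
  -- These invariants suffice, without conjugacy of the directions: one step changes `⟪x, A x⟫ - 2 *
  -- ⟪b, x⟫` by `-α * ⟪r, r⟫ ≤ 0`.
  suffices h : (cgState A b k).r = b - A (cgState A b k).x ∧
      ⟪(cgState A b k).r, (cgState A b k).p⟫ = ⟪(cgState A b k).r, (cgState A b k).r⟫ ∧
      ⟪(cgState A b k).x, A (cgState A b k).x⟫ ≤ 2 * ⟪b, (cgState A b k).x⟫ from h.2.2
  induction k with
  | zero => simp [cgState]
  | succ k ih =>
    obtain ⟨hr, hp, hx⟩ := ih
    simp only [cgState]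
    generalize cgState A b k = s at *
    obtain ⟨x, r, p⟩ := s
    simp only at *
    -- If `p = 0`, the second invariant forces `r = 0`, and the convention `0 / 0 = 0` freezes the
    -- state.
    by_cases hp0 : p = 0
    · subst hp0
      have hr0 : r = 0 := by
        rw [inner_zero_right] at hp
        exact inner_self_eq_zero.mp hp.symm
      subst hr0
      simpa using ⟨hr, hx⟩
    · have hpA := hpos p hp0
      set α : ℝ := ⟪r, r⟫ / ⟪p, A p⟫ with hα
      have hαA : α * ⟪p, A p⟫ = ⟪r, r⟫ := by rw [hα]; field_simp
      have hα0 : 0 ≤ α := div_nonneg real_inner_self_nonneg hpA.le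
      have horth : ⟪r - α • A p, p⟫ = 0 := by
        rw [inner_sub_left, real_inner_smul_left, real_inner_comm p (A p), hp, hαA, sub_self]
      refine ⟨by rw [hr, map_add, map_smul]; abel, ?_, ?_⟩
      · rw [inner_add_right, real_inner_smul_right, horth, mul_zero, add_zero]
      · have h1 : ⟪p, A x⟫ = ⟪b, p⟫ - ⟪r, r⟫ := by
          rw [← hp, hr, inner_sub_left, real_inner_comm p (A x)]; ring
        have h2 : ⟪x, A p⟫ = ⟪p, A x⟫ := by
          rw [← hsym x p, real_inner_comm]
        simp only [map_add, map_smul, inner_add_left, inner_add_right, real_inner_smul_left,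
          real_inner_smul_right, h2, hαA, h1]
        nlinarith [mul_nonneg hα0 (real_inner_self_nonneg (x := r))]

theorem hasGradientAt_of_abs_le [CompleteSpace V] {f : V → ℝ} {g W : V} {L : ℝ}
    (h : ∀ v, |f (W + v) - f W - ⟪g, v⟫| ≤ L * ‖v‖ ^ 2) : HasGradientAt f g W := by
  rw [hasGradientAt_iff_isLittleO_nhds_zero]
  have h1 : (fun v : V => f (W + v) - f W - ⟪g, v⟫) =O[𝓝 0] fun v => ‖v‖ ^ 2 :=
    IsBigO.of_bound L (Eventually.of_forall fun v => by simpa using h v)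
  refine h1.trans_isLittleO ?_
  have h2 : (fun v : V => ‖v‖ ^ 2) =o[𝓝 0] fun v => ‖v‖ ^ 1 :=
    (isLittleO_pow_pow (one_lt_two)).comp_tendsto tendsto_norm_zero
  simp only [pow_one] at h2
  exact h2.of_norm_right

/-- Turns the stopping test into a relative residual bound with a factor below one: split at `ρ`
between `η` and `1`, using the power below `ρ` and the constant `η` above it. -/
theorem exists_min_rpow_le {η τ : ℝ} (hη : η ∈ Set.Ioo (0 : ℝ) 1) (hτ : 0 < τ) :
    ∃ c < (1 : ℝ), ∀ x : ℝ, 0 ≤ x → min η (x ^ (1 + τ)) ≤ c * x := by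
  have hη0 := hη.1
  have hη1 := hη.2
  set ρ := (1 + η) / 2
  have hρ0 : 0 < ρ := by simp only [ρ]; linarith
  have hρ1 : ρ < 1 := by simp only [ρ]; linarith
  have hηρ : η < ρ := by simp only [ρ]; linarith
  refine ⟨max (ρ ^ τ) (η / ρ), max_lt (Real.rpow_lt_one hρ0.le hρ1 hτ)
    ((div_lt_one hρ0).mpr hηρ), fun x hx => ?_⟩
  rcases le_total x ρ with h | h
  · refine (min_le_right _ _).trans ?_
    rw [Real.rpow_add_of_nonneg hx zero_le_one hτ.le, Real.rpow_one, mul_comm]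
    gcongr
    exact (Real.rpow_le_rpow hx h hτ.le).trans (le_max_left _ _)
  · refine (min_le_left _ _).trans ?_
    calc η = η / ρ * ρ := by field_simp
      _ ≤ max (ρ ^ τ) (η / ρ) * x := by
        gcongr
        exact le_max_right _ _

/-- One step of an inexact Newton-CG method with Armijo line search for a function `f`
with gradient `g` and generalized Hessian `M`. -/
def IsNewtonCGStep (f : V → ℝ) (g : V → V) (M : V → V →ₗ[ℝ] V) (μ η τ δ : ℝ) (W W' : V) : Prop :=
  ∃ (d : V) (k m : ℕ), d = (cgState (M W) (-g W) k).x ∧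
    ‖M W d + g W‖ ≤ min η (‖g W‖ ^ (1 + τ)) ∧
    IsLeast {i : ℕ | f (W + δ ^ i • d) ≤ f W + μ * δ ^ i * ⟪g W, d⟫} m ∧
    W' = W + δ ^ m • d

/-- A strongly convex function with Lipschitz gradient, which has uniformly positive definite and
bounded generalized Hessians. -/
structure RegularObjective (f : V → ℝ) (g : V → V) (M : V → V →ₗ[ℝ] V) (l L : ℝ) : Prop where
  l_pos : 0 < l
  L_pos : 0 < L
  lower : ∀ W v, f W + ⟪g W, v⟫ + l / 2 * ‖v‖ ^ 2 ≤ f (W + v)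
  upper : ∀ W v, f (W + v) ≤ f W + ⟪g W, v⟫ + L * ‖v‖ ^ 2
  lipschitz : ∀ W v, ‖g (W + v) - g W‖ ≤ L * ‖v‖
  symm : ∀ W, (M W).IsSymmetric
  coercive : ∀ W v, l * ‖v‖ ^ 2 ≤ ⟪v, M W v⟫
  bounded : ∀ W v, ‖M W v‖ ≤ L * ‖v‖

namespace RegularObjective

variable {f : V → ℝ} {g : V → V} {M : V → V →ₗ[ℝ] V} {l L : ℝ}

theorem hasGradientAt [CompleteSpace V] (h : RegularObjective f g M l L) (W : V) :
    HasGradientAt f (g W) W := by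
  refine hasGradientAt_of_abs_le (L := L) fun v => abs_le.mpr ⟨?_, ?_⟩
  · have := h.lower W v
    nlinarith [h.l_pos, h.L_pos, sq_nonneg ‖v‖, mul_nonneg h.l_pos.le (sq_nonneg ‖v‖),
      mul_nonneg h.L_pos.le (sq_nonneg ‖v‖)]
  · linarith [h.upper W v]

theorem norm_le_norm_map (h : RegularObjective f g M l L) (W v : V) :
    l * ‖v‖ ≤ ‖M W v‖ := by
  rcases eq_or_ne v 0 with rfl | hv
  · simp
  · have h1 := (h.coercive W v).trans (real_inner_le_norm v (M W v))
    have hv' : 0 < ‖v‖ := norm_pos_iff.mpr hv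
    nlinarith

theorem strong_monotone (h : RegularObjective f g M l L) (W v : V) :
    l * ‖v‖ ≤ ‖g (W + v) - g W‖ := by
  rcases eq_or_ne v 0 with rfl | hv
  · simp
  · have h1 := h.lower W v
    have h2 := h.lower (W + v) (-v)
    rw [add_neg_cancel_right, norm_neg, inner_neg_right] at h2
    have h3 := real_inner_le_norm (g (W + v) - g W) v
    rw [inner_sub_left] at h3
    have hv' : 0 < ‖v‖ := norm_pos_iff.mpr hv
    nlinarith

theorem exists_minimizer [FiniteDimensional ℝ V] (h : RegularObjective f g M l L) :
    ∃ W, ∀ U, f W ≤ f U := by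
  have hcont : Continuous f := by
    rw [continuous_iff_continuousAt]
    exact fun W => (h.hasGradientAt W).continuousAt
  have hl := h.l_pos
  refine hcont.exists_forall_le' (0 : V) ?_
  -- Beyond this radius the quadratic term outweighs the linear one, so `f 0 ≤ f U`.
  have : ∀ᶠ U : V in cocompact V, 2 * ‖g 0‖ / l ≤ ‖U‖ :=
    (tendsto_norm_cocompact_atTop (E := V)).eventually_ge_atTop _
  filter_upwards [this] with U hU
  have h1 := h.lower 0 U
  rw [zero_add] at h1
  have h2 := (abs_le.mp (abs_real_inner_le_norm (g 0) U)).1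
  rw [div_le_iff₀ hl] at hU
  nlinarith [mul_nonneg (norm_nonneg U) (sub_nonneg.mpr hU)]

theorem gradient_eq_zero [CompleteSpace V] (h : RegularObjective f g M l L) {W : V}
    (hW : ∀ U, f W ≤ f U) : g W = 0 := by
  have h1 := IsLocalMin.hasFDerivAt_eq_zero (Eventually.of_forall hW) (h.hasGradientAt W).hasFDerivAt
  simpa using h1

/-- An inexact Newton-CG step decreases the objective in proportion to the squared gradient norm. -/
theorem exists_sufficient_decrease (h : RegularObjective f g M l L) {μ η τ δ : ℝ}
    (hμ : μ ∈ Set.Ioo (0 : ℝ) (1 / 2)) (hη : η ∈ Set.Ioo (0 : ℝ) 1) (hτ : 0 < τ)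
    (hδ : δ ∈ Set.Ioo (0 : ℝ) 1) :
    ∃ c > 0, ∀ W W', IsNewtonCGStep f g M μ η τ δ W W' → f W' ≤ f W - c * ‖g W‖ ^ 2 := by
  obtain ⟨θ, hθ1, hθ⟩ := exists_min_rpow_le hη hτ
  have hl := h.l_pos
  have hL := h.L_pos
  have hδ0 := hδ.1
  have hμ0 := hμ.1
  have hμ1 : 0 < 1 - μ := by linarith [hμ.2]
  -- A rejected trial step exceeds `(1 - μ) * l / (2 * L)`, and the accepted step is either `1` or
  -- `δ` times a rejected one.
  set t₀ := min 1 (δ * ((1 - μ) * l / (2 * L))) with ht₀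
  have ht₀pos : 0 < t₀ := by rw [ht₀]; positivity
  have hθ' : 0 < 1 - θ := by linarith
  refine ⟨μ * t₀ * (l / 2) * ((1 - θ) / L) ^ 2, by positivity, ?_⟩
  rintro W W' ⟨d, k, m, hd, hres, ⟨hm, hmin⟩, rfl⟩
  have hdesc : l / 2 * ‖d‖ ^ 2 ≤ -⟪g W, d⟫ := by
    have h1 := cgState_inner_le (M W) (h.symm W) (fun x hx => lt_of_lt_of_le
      (by have := norm_pos_iff.mpr hx; positivity) (h.coercive W x)) (-g W) k
    rw [← hd, inner_neg_left] at h1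
    linarith [h.coercive W d]
  -- The residual is at most `θ * ‖g W‖`, so `(1 - θ) * ‖g W‖ ≤ ‖M W d‖ ≤ L * ‖d‖`.
  have hdnorm : (1 - θ) / L * ‖g W‖ ≤ ‖d‖ := by
    have h1 := hres.trans (hθ _ (norm_nonneg _))
    have h2 := norm_sub_norm_le (g W) (-M W d)
    rw [sub_neg_eq_add, norm_neg, add_comm] at h2
    have h3 := h.bounded W d
    rw [div_mul_eq_mul_div, div_le_iff₀ hL]
    nlinarith
  have ht : t₀ ≤ δ ^ m := by
    rcases m with _ | i
    · rw [pow_zero]; exact min_le_left _ _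
    · refine (min_le_right _ _).trans ?_
      rw [pow_succ']
      gcongr
      have hi : ¬ f (W + δ ^ i • d) ≤ f W + μ * δ ^ i * ⟪g W, d⟫ := fun hi => by
        have := hmin hi
        omega
      rw [not_le] at hi
      have hup := h.upper W (δ ^ i • d)
      have hpow : 0 < δ ^ i := by positivity
      rw [real_inner_smul_right, norm_smul, Real.norm_of_nonneg hpow.le] at hup
      have h4 : δ ^ i * ((1 - μ) * (-⟪g W, d⟫)) < δ ^ i * (L * δ ^ i * ‖d‖ ^ 2) := by
        nlinarith
      have h5 := lt_of_mul_lt_mul_left h4 hpow.le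
      have h6 : (1 - μ) * (l / 2 * ‖d‖ ^ 2) < L * δ ^ i * ‖d‖ ^ 2 :=
        (mul_le_mul_of_nonneg_left hdesc hμ1.le).trans_lt h5
      have h7 : (1 - μ) * (l / 2) * ‖d‖ ^ 2 < L * δ ^ i * ‖d‖ ^ 2 := by linarith
      have h8 := lt_of_mul_lt_mul_right h7 (sq_nonneg _)
      rw [div_le_iff₀ (by positivity)]
      linarith
  have hm' : f (W + δ ^ m • d) ≤ f W + μ * δ ^ m * ⟪g W, d⟫ := hm
  have h9 : μ * t₀ * (l / 2 * ‖d‖ ^ 2) ≤ μ * δ ^ m * (-⟪g W, d⟫) := by gcongr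
  have h10 : μ * t₀ * (l / 2) * ((1 - θ) / L * ‖g W‖) ^ 2 ≤ μ * t₀ * (l / 2) * ‖d‖ ^ 2 := by
    gcongr
  rw [mul_pow] at h10
  linarith

/-- The values decrease and are bounded below, so their consecutive differences vanish; these
dominate the squared gradient norm, hence by strong monotonicity the squared distance to `W₀`. -/
theorem tendsto_minimizer (h : RegularObjective f g M l L) {μ η τ δ : ℝ}
    (hμ : μ ∈ Set.Ioo (0 : ℝ) (1 / 2)) (hη : η ∈ Set.Ioo (0 : ℝ) 1) (hτ : 0 < τ)
    (hδ : δ ∈ Set.Ioo (0 : ℝ) 1) {W : ℕ → V}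
    (hW : ∀ j, IsNewtonCGStep f g M μ η τ δ (W j) (W (j + 1))) {W₀ : V}
    (hmin : ∀ U, f W₀ ≤ f U) (hg : g W₀ = 0) : Tendsto W atTop (𝓝 W₀) := by
  obtain ⟨c, hc, hdec⟩ := h.exists_sufficient_decrease hμ hη hτ hδ
  have hl := h.l_pos
  have hstep := fun j => hdec _ _ (hW j)
  have hanti : Antitone fun j => f (W j) := antitone_nat_of_succ_le fun j => by
    have := hstep j
    nlinarith [mul_nonneg hc.le (sq_nonneg ‖g (W j)‖)]
  have hlim := tendsto_atTop_ciInf hanti ⟨f W₀, by rintro _ ⟨j, rfl⟩; exact hmin _⟩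
  have hdiff := (hlim.sub (hlim.comp (tendsto_add_atTop_nat 1))).div_const (c * l ^ 2)
  rw [sub_self, zero_div] at hdiff
  rw [tendsto_iff_norm_sub_tendsto_zero]
  have hsq : Tendsto (fun j => ‖W j - W₀‖ ^ 2) atTop (𝓝 0) := by
    refine squeeze_zero (fun j => sq_nonneg _) (fun j => ?_) hdiff
    have h1 := h.strong_monotone W₀ (W j - W₀)
    rw [add_sub_cancel, hg, sub_zero] at h1
    have h2 := hstep j
    have h3 : (l * ‖W j - W₀‖) ^ 2 ≤ ‖g (W j)‖ ^ 2 := by gcongr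
    rw [le_div_iff₀ (by positivity)]
    simp only [Function.comp_apply]
    nlinarith
  have := hsq.sqrt
  simpa using this

/-- Fast local convergence: once the generalized Hessian reproduces the gradient and the objective
exactly, the full Newton step is accepted, and it is of order `1 + τ`. -/
theorem isBigO_step (h : RegularObjective f g M l L) {μ η τ δ : ℝ}
    (hμ : μ ∈ Set.Ioo (0 : ℝ) (1 / 2)) (hτ : 0 < τ) {W : ℕ → V}
    (hW : ∀ j, IsNewtonCGStep f g M μ η τ δ (W j) (W (j + 1))) {W₀ : V} (hg : g W₀ = 0)
    (hlim : Tendsto W atTop (𝓝 W₀))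
    (hM : ∀ᶠ U in 𝓝 W₀, g U = M U (U - W₀))
    (hf : ∀ᶠ U in 𝓝 W₀, f U - f W₀ = 1 / 2 * ⟪U - W₀, g U⟫) :
    (fun j => ‖W (j + 1) - W₀‖) =O[atTop] fun j => ‖W j - W₀‖ ^ (1 + τ) := by
  have hl := h.l_pos
  have hL := h.L_pos
  have hμ1 : 0 < 1 / 2 - μ := by linarith [hμ.2]
  set C := L ^ (1 + τ) / l with hC
  have hC0 : 0 < C := by rw [hC]; positivity
  set κ := (1 / 2 - μ) * l with hκ
  have hκ0 : 0 < κ := by positivity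
  -- With `‖e'‖ ≤ q * ‖e‖` and `q = C * ‖e‖ ^ τ`, the unit step passes the Armijo test once `L * q ^
  -- 2 + L * q ≤ κ`.
  have hsmall : Tendsto (fun j => L * (C * ‖W j - W₀‖ ^ τ) ^ 2 +
      L * (C * ‖W j - W₀‖ ^ τ)) atTop (𝓝 0) := by
    have h1 : Tendsto (fun j => ‖W j - W₀‖ ^ τ) atTop (𝓝 0) := by
      have h0 := (tendsto_iff_norm_sub_tendsto_zero.mp hlim).rpow_const (p := τ) (Or.inr hτ.le)
      rwa [Real.zero_rpow hτ.ne'] at h0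
    have h2 := h1.const_mul C
    rw [mul_zero] at h2
    have h3 := ((h2.pow 2).const_mul L).add (h2.const_mul L)
    simpa using h3
  refine IsBigO.of_bound C ?_
  filter_upwards [hlim.eventually hM, hlim.eventually hf, hsmall.eventually (gt_mem_nhds hκ0)]
    with j hMj hfj hsj
  obtain ⟨d, k, m, -, hres, ⟨-, hmin⟩, hnext⟩ := hW j
  set e := W j - W₀ with he
  set e' := W j + d - W₀ with he'
  have hd : d = e' - e := by rw [he, he']; abel
  have hWj : W j = W₀ + e := by rw [he]; abel
  have hgle : ‖g (W j)‖ ≤ L * ‖e‖ := by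
    have h1 := h.lipschitz W₀ e
    rwa [← hWj, hg, sub_zero] at h1
  have hsplit : ‖e‖ ^ (1 + τ) = ‖e‖ ^ τ * ‖e‖ := by
    rw [Real.rpow_add_of_nonneg (norm_nonneg _) zero_le_one hτ.le, Real.rpow_one, mul_comm]
  have hnewton : ‖e'‖ ≤ C * ‖e‖ ^ (1 + τ) := by
    have h1 := h.norm_le_norm_map (W j) e'
    -- Since `g (W j) = M (W j) e`, the Hessian maps the new error exactly to the CG residual.
    have h2 : M (W j) e' = M (W j) d + g (W j) := by
      rw [hMj, ← map_add, hd, sub_add_cancel]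
    rw [h2] at h1
    have h3 := h1.trans (hres.trans (min_le_right _ _))
    have h4 : ‖g (W j)‖ ^ (1 + τ) ≤ L ^ (1 + τ) * ‖e‖ ^ (1 + τ) := by
      rw [← Real.mul_rpow hL.le (norm_nonneg _)]
      exact Real.rpow_le_rpow (norm_nonneg _) hgle (by linarith)
    rw [hC, div_mul_eq_mul_div, le_div_iff₀ hl]
    linarith
  -- The Newton model predicts a decrease of `⟪e, g⟫ / 2`, whereas Armijo asks for about `μ * ⟪e,
  -- g⟫`; the gap absorbs all terms in `e'`.
  have hunit : (0 : ℕ) ∈ {i : ℕ | f (W j + δ ^ i • d) ≤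
      f (W j) + μ * δ ^ i * ⟪g (W j), d⟫} := by
    simp only [Set.mem_ofPred_eq, pow_zero, one_smul, mul_one]
    set q := C * ‖e‖ ^ τ with hq
    have hq0 : 0 ≤ q := by rw [hq]; positivity
    have he'q : ‖e'‖ ≤ q * ‖e‖ := by rw [hsplit] at hnewton; rw [hq]; linarith
    have h1 : f (W j + d) ≤ f W₀ + L * ‖e'‖ ^ 2 := by
      have := h.upper W₀ e'
      rw [hg, inner_zero_left, add_zero] at this
      convert this using 2
      rw [he']; abel
    have h2 : l * ‖e‖ ^ 2 ≤ ⟪e, g (W j)⟫ := by rw [hMj]; exact h.coercive _ _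
    have h3 : |⟪g (W j), e'⟫| ≤ L * ‖e‖ * ‖e'‖ :=
      (abs_real_inner_le_norm _ _).trans (by gcongr)
    have h4 : ⟪g (W j), d⟫ = ⟪g (W j), e'⟫ - ⟪e, g (W j)⟫ := by
      rw [hd, inner_sub_right, real_inner_comm e]
    have h5 : L * ‖e'‖ ^ 2 ≤ L * q ^ 2 * ‖e‖ ^ 2 := by
      rw [mul_assoc, ← mul_pow]; gcongr
    have h6 : L * ‖e‖ * ‖e'‖ ≤ L * q * ‖e‖ ^ 2 := by
      calc L * ‖e‖ * ‖e'‖ ≤ L * ‖e‖ * (q * ‖e‖) := by gcongr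
        _ = L * q * ‖e‖ ^ 2 := by ring
    have h7 : (L * q ^ 2 + L * q) * ‖e‖ ^ 2 ≤ κ * ‖e‖ ^ 2 := by gcongr
    have h8 : κ * ‖e‖ ^ 2 ≤ (1 / 2 - μ) * ⟪e, g (W j)⟫ := by
      rw [hκ, mul_assoc]; gcongr
    have h9 : -(μ * ⟪g (W j), e'⟫) ≤ L * ‖e‖ * ‖e'‖ := by
      have hμ0 := hμ.1
      have := (abs_le.mp h3).1
      have h10 : 0 ≤ L * ‖e‖ * ‖e'‖ := by positivity
      nlinarith
    rw [h4]
    linarith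
  have hm0 : m = 0 := Nat.le_zero.mp (hmin hunit)
  rw [hnext, hm0, pow_zero, one_smul, norm_norm, Real.norm_of_nonneg (by positivity)]
  exact hnewton

theorem unique_minimizer (h : RegularObjective f g M l L) {W₀ U : V} (hg : g W₀ = 0)
    (hU : ∀ U', f U ≤ f U') : U = W₀ := by
  have h1 := h.lower W₀ (U - W₀)
  rw [hg, inner_zero_left, add_zero, add_sub_cancel] at h1
  have h2 := hU W₀
  have hl := h.l_pos
  have h3 : ‖U - W₀‖ ^ 2 ≤ 0 := by nlinarith
  have h4 : ‖U - W₀‖ = 0 := by nlinarith [norm_nonneg (U - W₀), sq_nonneg ‖U - W₀‖]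
  exact sub_eq_zero.mp (norm_eq_zero.mp h4)

end RegularObjective

end Abstract

namespace BirkhoffQP

/-! ### The pseudo-inverse on the range. -/

section PseudoInverse

variable {E F : Type*} [NormedAddCommGroup E] [InnerProductSpace ℝ E] [FiniteDimensional ℝ E]
    [NormedAddCommGroup F] [InnerProductSpace ℝ F] [FiniteDimensional ℝ F]

theorem apply_pinv_of_mem_range (A : E →ₗ[ℝ] F) {y : F} (hy : y ∈ LinearMap.range A) :
    A (pinv A y) = y := by
  have hc := (Submodule.isCompl_orthogonal (K := LinearMap.ker A)).symm
  set e := A.kerComplementEquivRange hc with he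
  have h1 : ∀ z, (e z : F) = A z := fun z => rfl
  have h2 : pinv A y = ((e.symm ⟨y, hy⟩ : (LinearMap.ker A)ᗮ) : E) := by
    have h3 : (LinearMap.range A).orthogonalProjectionOnto y = ⟨y, hy⟩ :=
      Submodule.orthogonalProjectionOnto_mem_subspace_eq_self (K := LinearMap.range A) ⟨y, hy⟩
    simp only [pinv, LinearMap.comp_apply, Submodule.subtype_apply, LinearEquiv.coe_coe,
      ContinuousLinearMap.coe_coe]
    rw [h3]
  rw [h2, ← h1, LinearEquiv.apply_symm_apply]

/-- `A ∘ₗ A.adjoint` is self-adjoint with the kernel of `A.adjoint`; take orthogonal complements. -/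
theorem range_comp_adjoint (A : E →ₗ[ℝ] F) :
    LinearMap.range (A ∘ₗ A.adjoint) = LinearMap.range A := by
  have h1 : (A ∘ₗ A.adjoint).adjoint = A ∘ₗ A.adjoint := by
    rw [LinearMap.adjoint_comp, LinearMap.adjoint_adjoint]
  have h2 := (A ∘ₗ A.adjoint).orthogonal_ker
  rw [h1, LinearMap.ker_self_comp_adjoint, ← LinearMap.orthogonal_range,
    Submodule.orthogonal_orthogonal] at h2
  exact h2.symm

end PseudoInverse

/-! ### The projector, minimal faces and the HS-Jacobian. -/

section Projector

variable {n : ℕ}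

theorem proj_mem (Y : MatSpace n) : proj Y ∈ birkhoff n := (exists_proj Y).choose_spec.1

theorem norm_sub_proj_le (Y : MatSpace n) {V : MatSpace n} (hV : V ∈ birkhoff n) :
    ‖Y - proj Y‖ ≤ ‖Y - V‖ := (exists_proj Y).choose_spec.2 V hV

theorem convex_birkhoff : Convex ℝ (birkhoff n) := by
  intro A hA B hB a b ha hb hab
  rw [mem_birkhoff] at *
  refine ⟨fun i j => ?_, fun i => ?_, fun j => ?_⟩
  · have h1 := hA.1 i j
    have h2 := hB.1 i j
    simp only [PiLp.add_apply, PiLp.smul_apply, smul_eq_mul]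
    positivity
  · simp [Finset.sum_add_distrib, ← Finset.mul_sum, hA.2.1, hB.2.1, hab]
  · simp [Finset.sum_add_distrib, ← Finset.mul_sum, hA.2.2, hB.2.2, hab]

theorem inner_sub_proj_le (Y : MatSpace n) {V : MatSpace n} (hV : V ∈ birkhoff n) :
    ⟪Y - proj Y, V - proj Y⟫ ≤ 0 := by
  refine (norm_eq_iInf_iff_real_inner_le_zero convex_birkhoff (proj_mem Y)).mp ?_ V hV
  have : Nonempty (birkhoff n) := ⟨⟨_, proj_mem Y⟩⟩
  refine le_antisymm (le_ciInf fun w => norm_sub_proj_le Y w.2) ?_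
  exact ciInf_le ⟨0, by rintro _ ⟨w, rfl⟩; exact norm_nonneg _⟩ (⟨_, proj_mem Y⟩ : birkhoff n)

/-- Firm nonexpansiveness: the sum of the variational inequalities at `U` and `Y`, each tested with
the other projection. -/
theorem norm_sq_proj_sub_le (U Y : MatSpace n) :
    ‖proj U - proj Y‖ ^ 2 ≤ ⟪U - Y, proj U - proj Y⟫ := by
  have h1 := inner_sub_proj_le U (proj_mem Y)
  have h2 := inner_sub_proj_le Y (proj_mem U)
  rw [← real_inner_self_eq_norm_sq]
  simp only [inner_sub_left, inner_sub_right] at *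
  linarith

theorem norm_proj_sub_le (U Y : MatSpace n) : ‖proj U - proj Y‖ ≤ ‖U - Y‖ := by
  have h := (norm_sq_proj_sub_le U Y).trans (real_inner_le_norm _ _)
  rcases (norm_nonneg (proj U - proj Y)).eq_or_lt with h0 | h0
  · rw [← h0]; exact norm_nonneg _
  · nlinarith

theorem continuous_proj : Continuous (proj : MatSpace n → MatSpace n) :=
  (LipschitzWith.of_dist_le_mul (K := 1) fun U Y => by
    simpa [dist_eq_norm] using norm_proj_sub_le U Y).continuous

/-- The matrices with zero row and column sums and with support in `s`. -/
def faceDirection (s : Set (Fin n × Fin n)) : Submodule ℝ (MatSpace n) where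
  carrier := {H | sums n H = 0 ∧ ∀ p, p ∉ s → H p = 0}
  zero_mem' := by simp
  add_mem' := by
    rintro H K ⟨h1, h2⟩ ⟨h3, h4⟩
    exact ⟨by rw [map_add, h1, h3, add_zero], fun p hp => by simp [h2 p hp, h4 p hp]⟩
  smul_mem' := by
    rintro c H ⟨h1, h2⟩
    exact ⟨by rw [map_smul, h1, smul_zero], fun p hp => by simp [h2 p hp]⟩

theorem sums_eq_iff {H K : MatSpace n} : sums n H = sums n K ↔
    (∀ i, ∑ j, H (i, j) = ∑ j, K (i, j)) ∧ ∀ j, ∑ i, H (i, j) = ∑ i, K (i, j) := by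
  refine ⟨fun h => ⟨fun i => ?_, fun j => ?_⟩, fun h => ?_⟩
  · simpa [sums] using congrArg (fun v => v (Sum.inl i)) h
  · simpa [sums] using congrArg (fun v => v (Sum.inr j)) h
  · ext k
    rcases k with i | j
    · simpa [sums] using h.1 i
    · simpa [sums] using h.2 j

theorem sums_eq_of_mem_birkhoff {A B : MatSpace n} (hA : A ∈ birkhoff n) (hB : B ∈ birkhoff n) :
    sums n A = sums n B := by
  rw [mem_birkhoff] at hA hB
  exact sums_eq_iff.mpr ⟨fun i => by rw [hA.2.1, hB.2.1], fun j => by rw [hA.2.2, hB.2.2]⟩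

theorem mem_birkhoff_of_sums_eq {A B : MatSpace n} (hA : A ∈ birkhoff n)
    (h : sums n B = sums n A) (hB : ∀ p, 0 ≤ B p) : B ∈ birkhoff n := by
  rw [mem_birkhoff] at hA ⊢
  rw [sums_eq_iff] at h
  exact ⟨fun i j => hB _, fun i => by rw [h.1, hA.2.1], fun j => by rw [h.2, hA.2.2]⟩

theorem nonneg_of_mem_birkhoff {A : MatSpace n} (hA : A ∈ birkhoff n) (p : Fin n × Fin n) :
    0 ≤ A p := (mem_birkhoff.mp hA).1 p.1 p.2

/-- The residual of the projection is orthogonal to the minimal face that contains the projection. -/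
theorem inner_sub_proj_faceDirection (Y : MatSpace n) {H : MatSpace n}
    (hH : H ∈ faceDirection {p | proj Y p ≠ 0}) : ⟪Y - proj Y, H⟫ = 0 := by
  -- Zero entries of `proj Y` are unchanged and the others are positive, so small moves along `H` of
  -- either sign stay in the polytope; the variational inequality then holds for both signs.
  have hev : ∀ᶠ t : ℝ in 𝓝 0, ∀ p, 0 ≤ (proj Y + t • H) p := by
    refine eventually_all.mpr fun p => ?_
    simp only [PiLp.add_apply, PiLp.smul_apply, smul_eq_mul]
    by_cases hp : proj Y p = 0
    · have h0 : H p = 0 := hH.2 p (by simpa using hp)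
      simp [hp, h0]
    · have h0 : 0 < proj Y p := lt_of_le_of_ne (nonneg_of_mem_birkhoff (proj_mem Y) p) (Ne.symm hp)
      have hc : Tendsto (fun t : ℝ => proj Y p + t * H p) (𝓝 0) (𝓝 (proj Y p)) := by
        have : Continuous fun t : ℝ => proj Y p + t * H p := by fun_prop
        simpa using this.tendsto 0
      filter_upwards [hc.eventually (lt_mem_nhds h0)] with t ht using ht.le
  have hineq : ∀ᶠ t : ℝ in 𝓝 0, t * ⟪Y - proj Y, H⟫ ≤ 0 := by
    filter_upwards [hev] with t ht
    have h1 := inner_sub_proj_le Y (mem_birkhoff_of_sums_eq (proj_mem Y)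
      (by rw [map_add, map_smul, hH.1, smul_zero, add_zero]) ht)
    rwa [add_sub_cancel_left, real_inner_smul_right] at h1
  obtain ⟨ε, hε, hball⟩ := Metric.eventually_nhds_iff.mp hineq
  have h1 := hball (y := ε / 2) (by simp [abs_of_pos hε, hε])
  have h2 := hball (y := -(ε / 2)) (by simp [abs_of_pos hε, hε])
  nlinarith

theorem mask_apply (Y H : MatSpace n) (p : Fin n × Fin n) [Decidable (proj Y p = 0)] :
    mask Y H p = if proj Y p = 0 then 0 else H p := by
  simp only [mask, LinearMap.coe_mk, AddHom.coe_mk]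
  congr

theorem mask_adjoint (Y : MatSpace n) : (mask Y).adjoint = mask Y := by
  classical
  symm
  rw [LinearMap.eq_adjoint_iff]
  intro H K
  simp only [PiLp.inner_apply, mask_apply]
  refine Finset.sum_congr rfl fun p _ => ?_
  by_cases h : proj Y p = 0 <;> simp [h]

theorem mask_mask (Y H : MatSpace n) : mask Y (mask Y H) = mask Y H := by
  classical
  ext p
  simp only [mask_apply]
  by_cases h : proj Y p = 0 <;> simp [h]

theorem mask_eq_self {Y H : MatSpace n} (hH : H ∈ faceDirection {p | proj Y p ≠ 0}) :
    mask Y H = H := by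
  classical
  ext p
  rw [mask_apply]
  by_cases h : proj Y p = 0
  · simp [h, hH.2 p (by simpa using h)]
  · simp [h]

/-- The HS-Jacobian is the orthogonal projection onto the direction space of the minimal face of the
Birkhoff polytope that contains the projection. -/
theorem hsJacobian_apply (Y H : MatSpace n) :
    hsJacobian Y H = (faceDirection {p | proj Y p ≠ 0}).starProjection H := by
  classical
  set A := sums n ∘ₗ mask Y with hA
  have hAadj : A.adjoint = mask Y ∘ₗ (sums n).adjoint := by
    rw [hA, LinearMap.adjoint_comp, mask_adjoint]
  -- As the mask is a self-adjoint idempotent, the operator is the mask minus `A* (A A*)† A`, which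
  -- removes the row and column sums of the masked matrix.
  have hAA : sums n ∘ₗ mask Y ∘ₗ (sums n).adjoint = A ∘ₗ A.adjoint := by
    rw [hAadj, hA]
    ext v : 1
    simp [mask_mask]
  set z := pinv (A ∘ₗ A.adjoint) (A H) with hz
  have hz' : A (A.adjoint z) = A H :=
    apply_pinv_of_mem_range (A ∘ₗ A.adjoint)
      (by rw [range_comp_adjoint]; exact LinearMap.mem_range_self _ _)
  have hP : hsJacobian Y H = mask Y H - A.adjoint z := by
    have h1 : A.adjoint z = mask Y ((sums n).adjoint z) := by rw [hAadj, LinearMap.comp_apply]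
    rw [hsJacobian, hAA, h1]
    rfl
  have hmask : mask Y (A.adjoint z) = A.adjoint z := by
    rw [hAadj, LinearMap.comp_apply, mask_mask]
  rw [hP]
  refine (Submodule.eq_starProjection_of_mem_of_inner_eq_zero ?_ ?_).symm
  · refine ⟨?_, fun p hp => ?_⟩
    · have h1 : sums n (mask Y H) = A H := rfl
      have h2 : sums n (A.adjoint z) = A (A.adjoint z) := by
        rw [hA, LinearMap.comp_apply, ← hA, hmask]
      rw [map_sub, h1, h2, hz', sub_self]
    · rw [← hmask, ← map_sub, mask_apply, if_pos (by simpa using hp)]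
  · intro K hK
    have h1 : ⟪mask Y H, K⟫ = ⟪H, K⟫ := by
      rw [← LinearMap.adjoint_inner_right, mask_adjoint, mask_eq_self hK]
    have h2 : ⟪A.adjoint z, K⟫ = 0 := by
      rw [LinearMap.adjoint_inner_left, hA, LinearMap.comp_apply, mask_eq_self hK, hK.1,
        inner_zero_right]
    rw [inner_sub_left, inner_sub_left, h1, h2]
    ring

/-- The projector is exactly linear along the HS-Jacobian near every point. -/
theorem eventually_proj_sub_eq (Y₀ : MatSpace n) :
    ∀ᶠ Y in 𝓝 Y₀, proj Y - proj Y₀ = hsJacobian Y (Y - Y₀) ∧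
      ⟪Y₀ - proj Y₀, proj Y - proj Y₀⟫ = 0 := by
  -- By continuity the support of `proj Y` can only grow near `Y₀`.
  have hsupp : ∀ᶠ Y in 𝓝 Y₀, ∀ p, proj Y p = 0 → proj Y₀ p = 0 := by
    refine eventually_all.mpr fun p => ?_
    by_cases hp : proj Y₀ p = 0
    · simp [hp]
    · have hc : Continuous fun Y : MatSpace n => proj Y p :=
        (EuclideanSpace.proj (𝕜 := ℝ) p).continuous.comp continuous_proj
      filter_upwards [hc.continuousAt.eventually_ne hp] with Y hY h using absurd h hY
  have horth : ∀ᶠ Y in 𝓝 Y₀, ∀ H ∈ faceDirection {p | proj Y p ≠ 0}, ⟪Y₀ - proj Y₀, H⟫ = 0 := by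
    -- There are finitely many supports. If `s` occurs arbitrarily close to `Y₀`, orthogonality to
    -- its face directions passes to the limit; otherwise `s` is absent near `Y₀`.
    have : ∀ᶠ Y in 𝓝 Y₀, ∀ s : Set (Fin n × Fin n), {p | proj Y p ≠ 0} = s →
        ∀ H ∈ faceDirection s, ⟪Y₀ - proj Y₀, H⟫ = 0 := by
      refine eventually_all.mpr fun s => ?_
      by_cases hs : ∃ᶠ Y in 𝓝 Y₀, {p | proj Y p ≠ 0} = s
      · refine Eventually.of_forall fun _ _ H hH => ?_
        have hcl : IsClosed {Y : MatSpace n | ⟪Y - proj Y, H⟫ = 0} :=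
          isClosed_eq ((continuous_id.sub continuous_proj).inner continuous_const)
            continuous_const
        refine hcl.mem_of_frequently_of_tendsto (hs.mono fun Y hY => ?_) tendsto_id
        subst hY
        exact inner_sub_proj_faceDirection Y hH
      · filter_upwards [not_frequently.mp hs] with Y hY h using absurd h hY
    filter_upwards [this] with Y hY using hY _ rfl
  filter_upwards [hsupp, horth] with Y h1 h2
  have hmem : proj Y - proj Y₀ ∈ faceDirection {p | proj Y p ≠ 0} := by
    refine ⟨by rw [map_sub, sums_eq_of_mem_birkhoff (proj_mem Y) (proj_mem Y₀), sub_self],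
      fun p hp => ?_⟩
    have hp' : proj Y p = 0 := by simpa using hp
    simp [hp', h1 p hp']
  refine ⟨?_, h2 _ hmem⟩
  rw [hsJacobian_apply]
  refine (Submodule.eq_starProjection_of_mem_of_inner_eq_zero hmem fun K hK => ?_).symm
  -- Subtracting the orthogonality relations at `Y` and `Y₀` characterizes `proj Y - proj Y₀` as the
  -- orthogonal projection of `Y - Y₀`.
  have h3 := inner_sub_proj_faceDirection Y hK
  have h4 := h2 K hK
  simp only [inner_sub_left] at *
  linarith

theorem norm_hsJacobian_le (Y H : MatSpace n) : ‖hsJacobian Y H‖ ≤ ‖H‖ := by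
  rw [hsJacobian_apply]
  exact Submodule.norm_starProjection_apply_le _ _

theorem hsJacobian_isSymmetric (Y : MatSpace n) : (hsJacobian Y).IsSymmetric := fun H K => by
  simp only [hsJacobian_apply]
  exact Submodule.starProjection_isSymmetric _ _ _

theorem inner_hsJacobian (Y H : MatSpace n) : ⟪H, hsJacobian Y H⟫ = ‖hsJacobian Y H‖ ^ 2 := by
  have h : hsJacobian Y (hsJacobian Y H) = hsJacobian Y H := by
    simp only [hsJacobian_apply]
    exact Submodule.starProjection_eq_self_iff.mpr (Submodule.starProjection_apply_mem _ _)
  rw [← real_inner_self_eq_norm_sq, hsJacobian_isSymmetric, h]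

end Projector

/-! ### Closed form of the reduced objective. -/

section Moreau

variable {n : ℕ}

/-- The maximum of `⟪U, V⟫ - ‖V‖ ^ 2 / 2` over the Birkhoff polytope, which is attained at `proj U`. -/
noncomputable def moreau (U : MatSpace n) : ℝ := ⟪U, proj U⟫ - 1 / 2 * ‖proj U‖ ^ 2

theorem inner_sub_le_moreau (U : MatSpace n) {V : MatSpace n} (hV : V ∈ birkhoff n) :
    ⟪U, V⟫ - 1 / 2 * ‖V‖ ^ 2 ≤ moreau U := by
  have h : ‖U - proj U‖ ^ 2 ≤ ‖U - V‖ ^ 2 :=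
    pow_le_pow_left₀ (norm_nonneg _) (norm_sub_proj_le U hV) 2
  rw [norm_sub_sq_real, norm_sub_sq_real] at h
  rw [moreau]
  linarith

theorem moreau_add_le (U H : MatSpace n) : moreau U + ⟪proj U, H⟫ ≤ moreau (U + H) := by
  have h := inner_sub_le_moreau (U + H) (proj_mem U)
  rw [inner_add_left, real_inner_comm (proj U) H] at h
  rw [moreau]
  linarith

theorem le_moreau_add (U H : MatSpace n) :
    moreau (U + H) ≤ moreau U + ⟪proj U, H⟫ + ‖H‖ ^ 2 := by
  have h1 := moreau_add_le (U + H) (-H)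
  rw [add_neg_cancel_right, inner_neg_right] at h1
  have h2 := real_inner_le_norm (proj (U + H) - proj U) H
  have h3 := norm_proj_sub_le (U + H) U
  rw [add_sub_cancel_left] at h3
  rw [inner_sub_left] at h2
  nlinarith [norm_nonneg H]

/-- An exact second-order expansion: the residual at `Y₀` is orthogonal to the change of projection,
whose squared norm is `⟪Y - Y₀, proj Y - proj Y₀⟫`. -/
theorem eventually_moreau_sub_eq (Y₀ : MatSpace n) :
    ∀ᶠ Y in 𝓝 Y₀, moreau Y - moreau Y₀ - ⟪Y - Y₀, proj Y₀⟫ =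
      1 / 2 * ⟪Y - Y₀, proj Y - proj Y₀⟫ := by
  filter_upwards [eventually_proj_sub_eq Y₀] with Y ⟨h1, h2⟩
  have h3 : ⟪Y - Y₀, proj Y - proj Y₀⟫ = ⟪proj Y - proj Y₀, proj Y - proj Y₀⟫ := by
    rw [h1, inner_hsJacobian, real_inner_self_eq_norm_sq]
  simp only [moreau, ← real_inner_self_eq_norm_sq]
  simp only [inner_sub_left, inner_sub_right] at *
  rw [real_inner_comm (proj Y) (proj Y₀)] at *
  linarith

theorem inner_le_supportFn (Z : MatSpace n) {V : MatSpace n} (hV : V ∈ birkhoff n) :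
    ⟪Z, V⟫ ≤ supportFn Z := by
  refine le_csSup ⟨∑ p, |Z p|, ?_⟩ ⟨V, hV, rfl⟩
  rintro _ ⟨P, hP, rfl⟩
  simp only [PiLp.inner_apply, RCLike.inner_apply, conj_trivial]
  refine Finset.sum_le_sum fun p _ => ?_
  have h0 := nonneg_of_mem_birkhoff hP p
  have h1 : P p ≤ 1 := by
    rw [← (mem_birkhoff.mp hP).2.1 p.1]
    exact Finset.single_le_sum (f := fun j => P (p.1, j))
      (fun j _ => nonneg_of_mem_birkhoff hP _) (Finset.mem_univ p.2)
  calc P p * Z p ≤ P p * |Z p| := by gcongr; exact le_abs_self _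
    _ ≤ 1 * |Z p| := by gcongr
    _ = |Z p| := one_mul _

/-- `U - proj U` lies in the normal cone at `proj U`, so the supremum is attained there. -/
theorem supportFn_smul_sub_proj (U : MatSpace n) {c : ℝ} (hc : 0 ≤ c) :
    supportFn (c • (U - proj U)) = ⟪c • (U - proj U), proj U⟫ := by
  refine le_antisymm (csSup_le ⟨_, proj U, proj_mem U, rfl⟩ ?_) (inner_le_supportFn _ (proj_mem U))
  rintro _ ⟨V, hV, rfl⟩
  have h := inner_sub_proj_le U hV
  rw [inner_sub_right] at h
  simp only [real_inner_smul_left]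
  gcongr
  linarith

/-- Completing the square in `Z`: with `P = proj (X - σ • R)` it yields both the lower bound for
`psi` and the minimizing `Z`. -/
theorem inner_augmented_eq {σ : ℝ} (hσ : 0 < σ) (Z R P X : MatSpace n) :
    ⟪Z, P⟫ - ⟪X, Z + R⟫ + σ / 2 * ‖Z + R‖ ^ 2 =
      (⟪X - σ • R, P⟫ - 1 / 2 * ‖P‖ ^ 2) / σ - ‖X‖ ^ 2 / (2 * σ) +
        1 / (2 * σ) * ‖σ • (Z + R) - (X - P)‖ ^ 2 := by
  rw [norm_sub_sq_real, norm_sub_sq_real, norm_smul, mul_pow, Real.norm_of_nonneg hσ.le]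
  simp only [inner_sub_left, inner_sub_right, inner_add_left, inner_add_right,
    real_inner_smul_left, real_inner_comm Z X, real_inner_comm R X]
  field_simp
  ring

theorem psi_eq (Q : MatSpace n →ₗ[ℝ] MatSpace n) (G : MatSpace n) {σ : ℝ} (hσ : 0 < σ)
    (X : MatSpace n) (W : LinearMap.range Q) :
    psi Q G σ X W = 1 / 2 * ⟪(W : MatSpace n), Q W⟫ + moreau (zOf Q G σ X W) / σ -
      ‖X‖ ^ 2 / (2 * σ) := by
  set U := zOf Q G σ X W with hU
  have hlow : ∀ Z, 1 / 2 * ⟪(W : MatSpace n), Q W⟫ + moreau U / σ - ‖X‖ ^ 2 / (2 * σ) ≤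
      augLagrangian Q G σ Z W X := fun Z => by
    have h1 := inner_augmented_eq hσ Z (Q W + G) (proj U) X
    have h2 := inner_le_supportFn Z (proj_mem U)
    have h3 : 0 ≤ 1 / (2 * σ) * ‖σ • (Z + (Q W + G)) - (X - proj U)‖ ^ 2 := by positivity
    rw [augLagrangian, moreau, add_assoc Z]
    have h4 : X - σ • (Q W + G) = U := rfl
    rw [h4] at h1
    linarith
  -- This `Z` makes the square vanish and has its support function attained at `proj U`.
  refine le_antisymm ((ciInf_le ⟨_, by rintro _ ⟨Z, rfl⟩; exact hlow Z⟩
    (σ⁻¹ • (U - proj U))).trans_eq ?_) (le_ciInf hlow)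
  have h1 := inner_augmented_eq hσ (σ⁻¹ • (U - proj U)) (Q W + G) (proj U) X
  have h4 : X - σ • (Q W + G) = U := rfl
  have h5 : σ • (σ⁻¹ • (U - proj U) + (Q W + G)) - (X - proj U) = 0 := by
    rw [smul_add, smul_inv_smul₀ hσ.ne', ← h4]
    abel
  rw [h4, h5, norm_zero] at h1
  rw [augLagrangian, moreau, add_assoc (σ⁻¹ • (U - proj U)),
    supportFn_smul_sub_proj U (inv_nonneg.mpr hσ.le)]
  linarith

end Moreau

/-! ### Regularity and local expansions of `psi` on the range of `Q`. -/

section Reduced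

variable {n : ℕ}

theorem exists_coercive_on_range {E : Type*} [NormedAddCommGroup E] [InnerProductSpace ℝ E]
    [FiniteDimensional ℝ E] {Q : E →ₗ[ℝ] E} (hQ : Q.IsPositive) :
    ∃ l > 0, ∀ v : LinearMap.range Q, l * ‖v‖ ^ 2 ≤ ⟪(v : E), Q v⟫ := by
  have hQc : Continuous Q := Q.continuous_of_finiteDimensional
  have hpos : ∀ v : LinearMap.range Q, v ≠ 0 → 0 < ⟪(v : E), Q v⟫ := by
    intro v hv
    have h0 : 0 ≤ ⟪(v : E), Q v⟫ := by simpa using hQ.inner_nonneg_right (v : E)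
    refine lt_of_le_of_ne h0 fun h => hv ?_
    have hQv : ∀ w : E, ⟪w, Q v⟫ = 0 := fun w => by
      -- If `⟪v, Q v⟫ = 0`, this nonnegative quadratic has no constant term, so its discriminant
      -- forces `⟪w, Q v⟫ = 0`. Then `Q v = 0`, and `v` in the range is orthogonal to itself.
      have hquad : ∀ t : ℝ, 0 ≤ ⟪w, Q w⟫ * (t * t) + 2 * ⟪w, Q v⟫ * t + 0 := fun t => by
        have h1 : 0 ≤ ⟪(v : E) + t • w, Q ((v : E) + t • w)⟫ := by
          simpa using hQ.inner_nonneg_right ((v : E) + t • w)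
        have h2 : ⟪(v : E), Q w⟫ = ⟪w, Q v⟫ := by
          rw [← hQ.isSymmetric, real_inner_comm]
        simp only [map_add, map_smul, inner_add_left, inner_add_right, real_inner_smul_left,
          real_inner_smul_right, ← h, h2] at h1
        linarith
      have h3 := discrim_le_zero hquad
      rw [discrim] at h3
      nlinarith [sq_nonneg ⟪w, Q v⟫]
    have hker : Q v = 0 := inner_self_eq_zero.mp (hQv (Q v))
    obtain ⟨u, hu⟩ := v.2
    have h4 : ⟪(v : E), (v : E)⟫ = 0 := by
      nth_rewrite 1 [← hu]
      rw [hQ.isSymmetric, hker, inner_zero_right]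
    exact Subtype.ext (inner_self_eq_zero.mp h4)
  by_cases hne : (Metric.sphere (0 : LinearMap.range Q) 1).Nonempty
  · obtain ⟨u, hu, hmin⟩ := (isCompact_sphere (0 : LinearMap.range Q) 1).exists_isMinOn hne
      (f := fun v : LinearMap.range Q => ⟪(v : E), Q v⟫)
      (continuous_subtype_val.inner (hQc.comp continuous_subtype_val)).continuousOn
    have hu0 : u ≠ 0 := ne_zero_of_mem_unit_sphere ⟨u, hu⟩
    refine ⟨_, hpos u hu0, fun v => ?_⟩
    rcases eq_or_ne v 0 with rfl | hv
    · simp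
    · have hv' : 0 < ‖v‖ := norm_pos_iff.mpr hv
      have h1 : ‖v‖⁻¹ • v ∈ Metric.sphere (0 : LinearMap.range Q) 1 := by
        rw [mem_sphere_zero_iff_norm, norm_smul, norm_inv, norm_norm, inv_mul_cancel₀ hv'.ne']
      have h2 := isMinOn_iff.mp hmin _ h1
      simp only [Submodule.coe_smul, map_smul, real_inner_smul_left, real_inner_smul_right] at h2
      have h3 := mul_le_mul_of_nonneg_right h2 (sq_nonneg ‖v‖)
      refine h3.trans_eq ?_
      field_simp
  · refine ⟨1, one_pos, fun v => ?_⟩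
    have hv : v = 0 := by
      by_contra hv
      exact hne ⟨‖v‖⁻¹ • v, by rw [mem_sphere_zero_iff_norm, norm_smul, norm_inv, norm_norm,
        inv_mul_cancel₀ (norm_ne_zero_iff.mpr hv)]⟩
    simp [hv]

/-- The gradient of `psi` on the range of `Q`. -/
noncomputable def psiGrad (Q : MatSpace n →ₗ[ℝ] MatSpace n) (G : MatSpace n) (σ : ℝ)
    (X : MatSpace n) (W : LinearMap.range Q) : LinearMap.range Q :=
  Q.rangeRestrict (W - proj (zOf Q G σ X W))

theorem coe_psiGrad (Q : MatSpace n →ₗ[ℝ] MatSpace n) (G : MatSpace n) (σ : ℝ)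
    (X : MatSpace n) (W : LinearMap.range Q) :
    (psiGrad Q G σ X W : MatSpace n) = Q W - Q (proj (zOf Q G σ X W)) := by
  rw [← map_sub]
  rfl

theorem coe_genHessian (Q : MatSpace n →ₗ[ℝ] MatSpace n) (G : MatSpace n) (σ : ℝ)
    (X : MatSpace n) (W v : LinearMap.range Q) :
    (genHessian Q G σ X W v : MatSpace n) =
      Q v + σ • Q (hsJacobian (zOf Q G σ X W) (Q v)) := rfl

theorem zOf_add (Q : MatSpace n →ₗ[ℝ] MatSpace n) (G : MatSpace n) (σ : ℝ)
    (X : MatSpace n) (W v : LinearMap.range Q) :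
    zOf Q G σ X (W + v) = zOf Q G σ X W + -(σ • Q v) := by
  simp only [zOf, Submodule.coe_add, map_add, smul_add]
  abel

theorem inner_psiGrad {Q : MatSpace n →ₗ[ℝ] MatSpace n} (hQ : Q.IsPositive) (G : MatSpace n)
    (σ : ℝ) (X : MatSpace n) (W v : LinearMap.range Q) :
    ⟪psiGrad Q G σ X W, v⟫ = ⟪Q W, (v : MatSpace n)⟫ - ⟪proj (zOf Q G σ X W), Q v⟫ := by
  rw [Submodule.coe_inner, coe_psiGrad, inner_sub_left, hQ.isSymmetric (proj _)]

theorem inner_add_map_add {Q : MatSpace n →ₗ[ℝ] MatSpace n} (hQ : Q.IsPositive)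
    (W v : MatSpace n) :
    ⟪W + v, Q (W + v)⟫ = ⟪W, Q W⟫ + 2 * ⟪Q W, v⟫ + ⟪v, Q v⟫ := by
  rw [map_add, inner_add_left, inner_add_right, inner_add_right, ← hQ.isSymmetric W v,
    real_inner_comm v (Q W)]
  ring

/-- All coercivity comes from `Q`; the projector only adds a convex term to `psi` and a positive
semidefinite one to the Hessian. Its nonexpansiveness contributes `σ * K ^ 2` to the upper bounds.
-/
theorem exists_regularObjective {Q : MatSpace n →ₗ[ℝ] MatSpace n} (hQ : Q.IsPositive)
    (G : MatSpace n) {σ : ℝ} (hσ : 0 < σ) (X : MatSpace n) :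
    ∃ l L, RegularObjective (psi Q G σ X) (psiGrad Q G σ X) (genHessian Q G σ X) l L := by
  obtain ⟨l, hl, hcoer⟩ := exists_coercive_on_range hQ
  obtain ⟨K, hK, hbound⟩ : ∃ K > 0, ∀ v : MatSpace n, ‖Q v‖ ≤ K * ‖v‖ :=
    Q.toContinuousLinearMap.bound
  refine ⟨l, K + σ * K ^ 2, ?_⟩
  have hQQ : ∀ v : MatSpace n, ‖Q v‖ ^ 2 ≤ K ^ 2 * ‖v‖ ^ 2 := fun v => by
    rw [← mul_pow]
    exact pow_le_pow_left₀ (norm_nonneg _) (hbound v) 2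
  constructor
  · exact hl
  · positivity
  · intro W v
    have h1 := moreau_add_le (zOf Q G σ X W) (-(σ • Q v))
    have h2 := hcoer v
    rw [psi_eq Q G hσ, psi_eq Q G hσ, inner_psiGrad hQ, zOf_add, Submodule.coe_add,
      inner_add_map_add hQ]
    rw [inner_neg_right, real_inner_smul_right] at h1
    have h3 := div_le_div_of_nonneg_right h1 hσ.le
    have h4 : (moreau (zOf Q G σ X W) + -(σ * ⟪proj (zOf Q G σ X W), Q v⟫)) / σ =
        moreau (zOf Q G σ X W) / σ - ⟪proj (zOf Q G σ X W), Q v⟫ := by field_simp; ring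
    rw [h4] at h3
    linarith
  · intro W v
    have h1 := le_moreau_add (zOf Q G σ X W) (-(σ • Q v))
    have h2 := real_inner_le_norm (v : MatSpace n) (Q v)
    have hv : ‖(v : MatSpace n)‖ = ‖v‖ := rfl
    have h2' : ⟪(v : MatSpace n), Q v⟫ ≤ K * ‖v‖ ^ 2 := by
      have := mul_le_mul_of_nonneg_left (hbound v) (norm_nonneg v)
      rw [hv] at this h2
      linarith
    have hKv : 0 ≤ K * ‖v‖ ^ 2 := by positivity
    rw [psi_eq Q G hσ, psi_eq Q G hσ, inner_psiGrad hQ, zOf_add, Submodule.coe_add,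
      inner_add_map_add hQ]
    rw [inner_neg_right, real_inner_smul_right, norm_neg, norm_smul, mul_pow,
      Real.norm_of_nonneg hσ.le] at h1
    have h3 := div_le_div_of_nonneg_right h1 hσ.le
    have h4 : (moreau (zOf Q G σ X W) + -(σ * ⟪proj (zOf Q G σ X W), Q v⟫) +
        σ ^ 2 * ‖Q v‖ ^ 2) / σ = moreau (zOf Q G σ X W) / σ -
          ⟪proj (zOf Q G σ X W), Q v⟫ + σ * ‖Q v‖ ^ 2 := by field_simp; ring
    rw [h4] at h3
    have h5 := mul_le_mul_of_nonneg_left (hQQ v) hσ.le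
    rw [hv] at h5
    linarith
  · intro W v
    have h1 : ((psiGrad Q G σ X (W + v) - psiGrad Q G σ X W : LinearMap.range Q) : MatSpace n) =
        Q v - Q (proj (zOf Q G σ X (W + v)) - proj (zOf Q G σ X W)) := by
      rw [Submodule.coe_sub, coe_psiGrad, coe_psiGrad, Submodule.coe_add, map_add, map_sub]
      abel
    have h2 := norm_proj_sub_le (zOf Q G σ X (W + v)) (zOf Q G σ X W)
    rw [zOf_add, add_sub_cancel_left, norm_neg, norm_smul, Real.norm_of_nonneg hσ.le,
      ← zOf_add] at h2
    have hv := hbound v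
    rw [Submodule.coe_norm, h1, Submodule.coe_norm]
    calc _ ≤ ‖Q v‖ + ‖Q (proj (zOf Q G σ X (W + v)) - proj (zOf Q G σ X W))‖ := norm_sub_le _ _
      _ ≤ K * ‖(v : MatSpace n)‖ + K * (σ * (K * ‖(v : MatSpace n)‖)) :=
        add_le_add hv ((hbound _).trans (by gcongr; exact h2.trans (by gcongr)))
      _ = _ := by ring
  · intro W v w
    simp only [Submodule.coe_inner, coe_genHessian, inner_add_left, inner_add_right,
      real_inner_smul_left, real_inner_smul_right]
    rw [hQ.isSymmetric v w, hQ.isSymmetric, hsJacobian_isSymmetric, hQ.isSymmetric v]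
  · intro W v
    rw [Submodule.coe_inner, coe_genHessian, inner_add_right, real_inner_smul_right,
      ← hQ.isSymmetric v (hsJacobian _ _), inner_hsJacobian]
    have := hcoer v
    have : 0 ≤ σ * ‖hsJacobian (zOf Q G σ X W) (Q v)‖ ^ 2 := by positivity
    linarith
  · intro W v
    have hv := hbound v
    rw [Submodule.coe_norm, coe_genHessian, Submodule.coe_norm]
    calc _ ≤ ‖Q v‖ + ‖σ • Q (hsJacobian (zOf Q G σ X W) (Q v))‖ := norm_add_le _ _
      _ ≤ K * ‖(v : MatSpace n)‖ + σ * (K * (K * ‖(v : MatSpace n)‖)) := by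
        rw [norm_smul, Real.norm_of_nonneg hσ.le]
        gcongr
        exact (hbound _).trans (by gcongr; exact (norm_hsJacobian_le _ _).trans hv)
      _ = _ := by ring

theorem continuous_zOf (Q : MatSpace n →ₗ[ℝ] MatSpace n) (G : MatSpace n) (σ : ℝ)
    (X : MatSpace n) : Continuous (zOf Q G σ X) := by
  have hQc : Continuous Q := Q.continuous_of_finiteDimensional
  unfold zOf
  fun_prop

theorem zOf_sub_zOf (Q : MatSpace n →ₗ[ℝ] MatSpace n) (G : MatSpace n) (σ : ℝ)
    (X : MatSpace n) (U W : LinearMap.range Q) :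
    zOf Q G σ X U - zOf Q G σ X W = -(σ • Q (U - W : LinearMap.range Q)) := by
  have h := zOf_add Q G σ X W (U - W)
  rw [add_sub_cancel] at h
  rw [h, add_sub_cancel_left]

theorem eventually_psiGrad_sub_eq (Q : MatSpace n →ₗ[ℝ] MatSpace n) (G : MatSpace n) (σ : ℝ)
    (X : MatSpace n) (W : LinearMap.range Q) :
    ∀ᶠ U in 𝓝 W, psiGrad Q G σ X U - psiGrad Q G σ X W = genHessian Q G σ X U (U - W) := by
  filter_upwards [((continuous_zOf Q G σ X).tendsto W).eventually (eventually_proj_sub_eq _)]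
    with U ⟨hU, _⟩
  rw [zOf_sub_zOf, map_neg, map_smul] at hU
  apply Subtype.ext
  rw [Submodule.coe_sub, coe_psiGrad, coe_psiGrad, coe_genHessian]
  have h1 := congrArg Q hU
  rw [map_sub, map_neg, map_smul] at h1
  rw [Submodule.coe_sub, map_sub Q (U : MatSpace n)] at *
  rw [← neg_eq_iff_eq_neg] at h1
  rw [← h1]
  abel

/-- The quadratic part satisfies this identity everywhere; the Moreau part satisfies it locally,
through the affine map `zOf`. -/
theorem eventually_psi_sub_eq {Q : MatSpace n →ₗ[ℝ] MatSpace n} (hQ : Q.IsPositive)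
    (G : MatSpace n) {σ : ℝ} (hσ : 0 < σ) (X : MatSpace n) (W : LinearMap.range Q) :
    ∀ᶠ U in 𝓝 W, psi Q G σ X U - psi Q G σ X W - ⟪psiGrad Q G σ X W, U - W⟫ =
      1 / 2 * ⟪U - W, psiGrad Q G σ X U - psiGrad Q G σ X W⟫ := by
  filter_upwards [((continuous_zOf Q G σ X).tendsto W).eventually (eventually_moreau_sub_eq _)]
    with U hU
  obtain ⟨v, rfl⟩ : ∃ v, U = W + v := ⟨U - W, by abel⟩
  rw [zOf_sub_zOf, add_sub_cancel_left] at hU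
  rw [add_sub_cancel_left, real_inner_comm (_ - _) v, inner_sub_left,
    inner_psiGrad hQ G σ X W, inner_psiGrad hQ G σ X (W + v),
    psi_eq Q G hσ, psi_eq Q G hσ, Submodule.coe_add, inner_add_map_add hQ, map_add,
    inner_add_left, real_inner_comm (v : MatSpace n) (Q v)]
  simp only [inner_neg_left, real_inner_smul_left, inner_sub_right] at hU
  rw [real_inner_comm, real_inner_comm (proj (zOf Q G σ X (W + v)))] at hU
  have h1 : moreau (zOf Q G σ X (W + v)) / σ = moreau (zOf Q G σ X W) / σ -
      ⟪proj (zOf Q G σ X W), Q v⟫ - 1 / 2 * (⟪proj (zOf Q G σ X (W + v)), Q v⟫ -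
        ⟪proj (zOf Q G σ X W), Q v⟫) := by
    field_simp
    linarith
  rw [h1]
  ring

end Reduced

end BirkhoffQP

theorem mainTheorem5 (n : ℕ) (Q : MatSpace n →ₗ[ℝ] MatSpace n) (hQ : Q.IsPositive)
    (G X : MatSpace n) (σ : ℝ) (hσ : 0 < σ)
    (μ ηbar τ δ : ℝ) (hμ : μ ∈ Set.Ioo (0 : ℝ) (1 / 2)) (hη : ηbar ∈ Set.Ioo (0 : ℝ) 1)
    (hτ : τ ∈ Set.Ioc (0 : ℝ) 1) (hδ : δ ∈ Set.Ioo (0 : ℝ) 1)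
    (W : ℕ → LinearMap.range Q)
    (hW : ∀ j, IsStep Q G σ X μ ηbar τ δ (W j) (W (j + 1))) :
    ∃ Wbar : LinearMap.range Q,
      (∀ V, psi Q G σ X Wbar ≤ psi Q G σ X V) ∧
      (∀ V, (∀ U, psi Q G σ X V ≤ psi Q G σ X U) → V = Wbar) ∧
      Tendsto W atTop (𝓝 Wbar) ∧
      (fun j => ‖W (j + 1) - Wbar‖) =O[atTop] fun j => ‖W j - Wbar‖ ^ (1 + τ) := by
  obtain ⟨l, L, h⟩ := exists_regularObjective hQ G hσ X
  have hgrad : ∀ V, gradient (psi Q G σ X) V = psiGrad Q G σ X V := fun V =>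
    (h.hasGradientAt V).gradient
  have hstep : ∀ j, IsNewtonCGStep (psi Q G σ X) (psiGrad Q G σ X) (genHessian Q G σ X)
      μ ηbar τ δ (W j) (W (j + 1)) := fun j => by
    have := hW j
    simp only [IsStep, hgrad] at this
    exact this
  obtain ⟨W₀, hmin⟩ := h.exists_minimizer
  have hg := h.gradient_eq_zero hmin
  have hlim := h.tendsto_minimizer hμ hη hτ.1 hδ hstep hmin hg
  refine ⟨W₀, hmin, fun V hV => h.unique_minimizer hg hV, hlim, ?_⟩
  refine h.isBigO_step hμ hτ.1 hstep hg hlim ?_ ?_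
  · simpa only [hg, sub_zero] using eventually_psiGrad_sub_eq Q G σ X W₀
  · simpa only [hg, sub_zero, inner_zero_left] using eventually_psi_sub_eq hQ G hσ X W₀
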